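/- Let $f:\mathbb{R}\to\mathbb{R}$ be a $C^\infty$, $1$-periodic function with $f(t)>0$ for all $t$. For every real $a>0$ there is exactly one differentiable function $\lambda_a:\mathbb{R}\to\mathbb{R}$ that is $1$-periodic, positive everywhere, and satisfies $$\lambda_a'(t)+\lambda_a(t)^2=a^2 f(t)\qquad\text{for all } t\in\mathbb{R};$$ moreover $\lambda_a$ is $C^\infty$. Put $\Lambda(a)=\int_0^1\lambda_a(t)\,dt$ for $a>0$. Then the function $$a\longmapsto \frac{\Lambda(a)}{a}$$ is non-increasing on $(0,\infty)$. Moreover, for every $0<a<1$, $$\Lambda(a)\le\Lambda(1)\le\frac{\Lambda(a)}{a}.$$ -/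

import Mathlib

open scoped ContDiff

/-- `lam` is a positive `1`-periodic solution on `ℝ` of the Riccati equation
`lam' + lam ^ 2 = a ^ 2 * f`. -/
structure IsPosPeriodicRiccatiSol (f : ℝ → ℝ) (a : ℝ) (lam : ℝ → ℝ) : Prop where
  pos : ∀ t : ℝ, 0 < lam t
  periodic : Function.Periodic lam 1
  differentiable : Differentiable ℝ lam
  riccati : ∀ t : ℝ, deriv lam t + lam t ^ 2 = a ^ 2 * f t

/-- The integral of a function over one period `[0, 1]`. -/
noncomputable def periodIntegral (g : ℝ → ℝ) : ℝ := ∫ t in (0 : ℝ)..1, g t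

open scoped BoundedContinuousFunction

/-! At a minimum of a periodic function the derivative vanishes. This minimum principle gives
comparison of solutions, hence uniqueness and `Λ(a) ≤ Λ(1)`, and also the bounds behind the
contraction argument for existence. For the quotient, put `x = lam₁ / a`, `y = lam₂ / b`, so that
`x' / a + x ^ 2 = f = y' / b + y ^ 2`. In `periodIntegral_div_le`, `2 * (x - y)` is written as the
derivative of a periodic function plus a nonnegative remainder; integrating over a period leaves
only the remainder. -/

lemma Function.Periodic.exists_forall_ge_of_continuous {d : ℝ → ℝ} (hp : Function.Periodic d 1)
    (hc : Continuous d) : ∃ t₀, ∀ t, d t₀ ≤ d t := by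
  have hK : IsCompact (Set.range d) := hp.compact_of_continuous one_ne_zero hc
  obtain ⟨y, ⟨t₀, rfl⟩, h⟩ := hK.exists_isLeast (Set.range_nonempty d)
  exact ⟨t₀, fun t => h (Set.mem_range_self t)⟩

/-- Minimum principle for periodic subsolutions of a first order linear equation. -/
lemma Function.Periodic.nonneg_of_deriv_add_mul_nonneg {d p : ℝ → ℝ}
    (hper : Function.Periodic d 1) (hd : Differentiable ℝ d) (hp : ∀ t, 0 < p t)
    (h : ∀ t, 0 ≤ deriv d t + p t * d t) (t : ℝ) : 0 ≤ d t := by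
  obtain ⟨t₀, ht₀⟩ := hper.exists_forall_ge_of_continuous hd.continuous
  have hmin : IsLocalMin d t₀ := Filter.Eventually.of_forall ht₀
  have h₀ := h t₀
  rw [hmin.deriv_eq_zero, zero_add] at h₀
  exact (nonneg_of_mul_nonneg_right h₀ (hp t₀)).trans (ht₀ t)

/-- A first order linear equation with constant positive coefficient and continuous periodic
right-hand side has a periodic solution. -/
lemma exists_periodic_hasDerivAt_sub_mul {h : ℝ → ℝ} (hc : Continuous h)
    (hper : Function.Periodic h 1) {K : ℝ} (hK : 0 < K) :
    ∃ u : ℝ → ℝ, Function.Periodic u 1 ∧ ∀ t, HasDerivAt u (h t - K * u t) t := by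
  set J : ℝ → ℝ := fun t => ∫ s in (0 : ℝ)..t, Real.exp (K * s) * h s with hJ
  have hJd : ∀ t, HasDerivAt J (Real.exp (K * t) * h t) t := fun t =>
    intervalIntegral.integral_hasDerivAt_right
      ((by fun_prop : Continuous fun s => Real.exp (K * s) * h s).intervalIntegrable _ _)
      (by fun_prop : Continuous fun s => Real.exp (K * s) * h s).stronglyMeasurable.stronglyMeasurableAtFilter
      (by fun_prop : Continuous fun s => Real.exp (K * s) * h s).continuousAt
  have hsol : ∀ C t, HasDerivAt (fun t => Real.exp (-(K * t)) * (C + J t))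
      (h t - K * (Real.exp (-(K * t)) * (C + J t))) t := by
    intro C t
    have h1 : HasDerivAt (fun t : ℝ => Real.exp (-(K * t))) (Real.exp (-(K * t)) * -(K * 1)) t :=
      (((hasDerivAt_id t).const_mul K).neg).exp
    have h2 := h1.mul ((hJd t).const_add C)
    have : Real.exp (-(K * t)) * Real.exp (K * t) = 1 := by
      rw [← Real.exp_add]; simp
    refine h2.congr_deriv ?_
    linear_combination (h t) * this
  have hK1 : 0 < Real.exp K - 1 := by
    have := Real.one_lt_exp_iff.2 hK
    linarith
  -- The constant in the variation of constants formula is chosen so that `u 1 = u 0`.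
  obtain ⟨C, hC⟩ : ∃ C, Real.exp (-K) * (C + J 1) = C := by
    refine ⟨J 1 / (Real.exp K - 1), ?_⟩
    rw [Real.exp_neg]
    field_simp
    ring
  refine ⟨_, ?_, hsol C⟩
  set u : ℝ → ℝ := fun t => Real.exp (-(K * t)) * (C + J t) with hu
  -- `u (t + 1) - u t` solves the homogeneous equation, so its vanishing at `0` propagates.
  have hw : ∀ t, HasDerivAt (fun t => Real.exp (K * t) * (u (t + 1) - u t)) 0 t := by
    intro t
    have h1 : HasDerivAt (fun t : ℝ => Real.exp (K * t)) (Real.exp (K * t) * (K * 1)) t :=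
      ((hasDerivAt_id t).const_mul K).exp
    have h2 := h1.mul (((hsol C (t + 1)).comp_add_const t 1).sub (hsol C t))
    refine h2.congr_deriv ?_
    rw [hper t]
    simp only [Pi.sub_apply]
    ring
  intro t
  have := is_const_of_deriv_eq_zero (fun t => (hw t).differentiableAt) (fun t => (hw t).deriv) t 0
  have h0 : u (0 + 1) - u 0 = 0 := by
    have hJ0 : J 0 = 0 := by simp [hJ]
    simp only [hu, hJ0]
    simp
    linarith
  rw [h0, mul_zero] at this
  have := (mul_eq_zero.1 this).resolve_left (Real.exp_pos _).ne'
  linarith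

/-- If the forcing term lies in `[m ^ 2, M ^ 2]`, the Riccati equation has a periodic solution with
values in `[m, M]`. -/
lemma exists_periodic_riccati {g : ℝ → ℝ} (hg : Continuous g) (hper : Function.Periodic g 1)
    {m M : ℝ} (hm : 0 < m) (hmM : m ≤ M) (hgm : ∀ t, m ^ 2 ≤ g t) (hgM : ∀ t, g t ≤ M ^ 2) :
    ∃ u : ℝ → ℝ, Function.Periodic u 1 ∧ (∀ t, m ≤ u t) ∧
      ∀ t, HasDerivAt u (g t - u t ^ 2) t := by
  have hM : 0 < M := hm.trans_le hmM
  let S : Set (ℝ →ᵇ ℝ) := {φ | ∀ t, φ (t + 1) = φ t ∧ m ≤ φ t ∧ φ t ≤ M}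
  have hS : IsClosed S := by
    simp only [S, Set.ofPred_forall]
    refine isClosed_iInter fun t => ?_
    have hev : ∀ t, Continuous fun φ : ℝ →ᵇ ℝ => φ t :=
      fun t => continuous_eval_const t
    exact (isClosed_eq (hev _) (hev _)).inter
      ((isClosed_le continuous_const (hev _)).inter (isClosed_le (hev _) continuous_const))
  have hne : Nonempty S :=
    ⟨⟨BoundedContinuousFunction.const ℝ m, fun t => ⟨rfl, le_rfl, hmM⟩⟩⟩
  have : CompleteSpace S := hS.completeSpace_coe
  -- Adding `2 * M * u` to both sides makes `x ↦ 2 * M * x - x ^ 2` increasing on `[m, M]` with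
  -- slope at most `2 * (M - m)`. Hence `S` is preserved, and the contraction ratio is `2 * (M - m)
  -- / (2 * M) = 1 - m / M`.
  have hstep : ∀ φ : S, ∃ ψ : S,
      ∀ t, HasDerivAt ψ.1 (2 * M * φ.1 t - φ.1 t ^ 2 + g t - 2 * M * ψ.1 t) t := by
    rintro ⟨φ, hφ⟩
    obtain ⟨u, hup, hu⟩ := exists_periodic_hasDerivAt_sub_mul
      (h := fun t => 2 * M * φ t - φ t ^ 2 + g t) (by fun_prop)
      (fun t => by simp only [(hφ t).1, hper t]) (mul_pos two_pos hM)
    have hud : Differentiable ℝ u := fun t => (hu t).differentiableAt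
    have hlo : ∀ t, m ≤ u t := by
      intro t
      refine sub_nonneg.1 (Function.Periodic.nonneg_of_deriv_add_mul_nonneg
        (d := fun t => u t - m) (p := fun _ => 2 * M)
        (fun t => by simp only [hup t]) (hud.sub_const m) (fun _ => by positivity) (fun t => ?_) t)
      rw [((hu t).sub_const m).deriv]
      nlinarith [hφ t, hgm t, mul_nonneg (sub_nonneg.2 (hφ t).2.1)
        (by linarith [(hφ t).2.2] : 0 ≤ 2 * M - φ t - m)]
    have hhi : ∀ t, u t ≤ M := by
      intro t
      refine sub_nonneg.1 (Function.Periodic.nonneg_of_deriv_add_mul_nonneg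
        (d := fun t => M - u t) (p := fun _ => 2 * M)
        (fun t => by simp only [hup t]) (hud.const_sub M) (fun _ => by positivity) (fun t => ?_) t)
      rw [((hu t).const_sub M).deriv]
      nlinarith [hgM t, sq_nonneg (M - φ t)]
    exact ⟨⟨BoundedContinuousFunction.ofNormedAddCommGroup u hud.continuous M fun t => by
      rw [Real.norm_of_nonneg (hm.le.trans (hlo t))]; exact hhi t,
      fun t => ⟨hup t, hlo t, hhi t⟩⟩, hu⟩
  choose T hT using hstep
  have hle : ∀ φ₁ φ₂ : S, ∀ t,
      (T φ₁).1 t - (T φ₂).1 t ≤ (1 - m / M) * dist φ₁ φ₂ := by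
    intro φ₁ φ₂ t
    refine sub_nonneg.1 (Function.Periodic.nonneg_of_deriv_add_mul_nonneg
      (d := fun t => (1 - m / M) * dist φ₁ φ₂ - ((T φ₁).1 t - (T φ₂).1 t)) (p := fun _ => 2 * M)
      (fun t => by simp only [((T φ₁).2 t).1, ((T φ₂).2 t).1])
      (fun t => (((hT φ₁ t).sub (hT φ₂ t)).const_sub _).differentiableAt)
      (fun _ => by positivity) (fun t => ?_) t)
    have hder : deriv (fun t => (1 - m / M) * dist φ₁ φ₂ - ((T φ₁).1 t - (T φ₂).1 t)) t = _ :=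
      (((hT φ₁ t).sub (hT φ₂ t)).const_sub ((1 - m / M) * dist φ₁ φ₂)).deriv
    rw [hder]
    have hdist : φ₁.1 t - φ₂.1 t ≤ dist φ₁ φ₂ :=
      (le_abs_self _).trans (BoundedContinuousFunction.dist_coe_le_dist (f := φ₁.1) (g := φ₂.1) t)
    have h1 := φ₁.2 t
    have h2 := φ₂.2 t
    have hD : 0 ≤ dist φ₁ φ₂ := dist_nonneg
    have hcoef : 2 * M * ((1 - m / M) * dist φ₁ φ₂) = (2 * M - 2 * m) * dist φ₁ φ₂ := by
      field_simp
    have hkey : (2 * M - φ₁.1 t - φ₂.1 t) * (φ₁.1 t - φ₂.1 t)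
        ≤ (2 * M - 2 * m) * dist φ₁ φ₂ :=
      (mul_le_mul_of_nonneg_left hdist (by linarith [h1.2.2, h2.2.2])).trans
        (mul_le_mul_of_nonneg_right (by linarith [h1.2.1, h2.2.1]) hD)
    linarith
  have hmM1 : 0 ≤ 1 - m / M := sub_nonneg.2 ((div_le_one hM).2 hmM)
  have hcontr : ContractingWith (1 - m / M).toNNReal T := by
    refine ⟨?_, LipschitzWith.of_dist_le_mul fun φ₁ φ₂ => ?_⟩
    · rw [← NNReal.coe_lt_coe, Real.coe_toNNReal _ hmM1]
      simpa using div_pos hm hM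
    · rw [Real.coe_toNNReal _ hmM1, Subtype.dist_eq,
        BoundedContinuousFunction.dist_le (mul_nonneg hmM1 dist_nonneg)]
      intro t
      rw [Real.dist_eq, abs_sub_le_iff]
      refine ⟨hle φ₁ φ₂ t, ?_⟩
      rw [dist_comm]
      exact hle φ₂ φ₁ t
  set φ : S := ContractingWith.fixedPoint T hcontr
  have hfix : T φ = φ := hcontr.fixedPoint_isFixedPt
  refine ⟨φ.1, fun t => (φ.2 t).1, fun t => (φ.2 t).2.1, fun t => ?_⟩
  have := hT φ t
  rw [hfix] at this
  convert this using 1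
  ring

namespace IsPosPeriodicRiccatiSol

variable {f lam lam₁ lam₂ : ℝ → ℝ} {a b : ℝ}

lemma hasDerivAt (h : IsPosPeriodicRiccatiSol f a lam) (t : ℝ) :
    HasDerivAt lam (a ^ 2 * f t - lam t ^ 2) t := by
  have := (h.differentiable t).hasDerivAt
  rwa [eq_sub_of_add_eq (h.riccati t)] at this

/-- The difference `d = lam₂ - lam₁` satisfies `d' + (lam₁ + lam₂) * d = (b ^ 2 - a ^ 2) * f ≥ 0`.
The case `a = b` gives uniqueness. -/
lemma le_of_le (h₁ : IsPosPeriodicRiccatiSol f a lam₁) (h₂ : IsPosPeriodicRiccatiSol f b lam₂)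
    (hf : ∀ t, 0 ≤ f t) (ha : 0 ≤ a) (hab : a ≤ b) (t : ℝ) : lam₁ t ≤ lam₂ t := by
  refine sub_nonneg.1 (Function.Periodic.nonneg_of_deriv_add_mul_nonneg
    (d := fun t => lam₂ t - lam₁ t) (p := fun t => lam₂ t + lam₁ t)
    (fun t => by simp only [h₁.periodic t, h₂.periodic t])
    (h₂.differentiable.sub h₁.differentiable) (fun t => add_pos (h₂.pos t) (h₁.pos t))
    (fun t => ?_) t)
  have hder := ((h₂.hasDerivAt t).sub (h₁.hasDerivAt t)).deriv
  rw [show (fun t => lam₂ t - lam₁ t) = lam₂ - lam₁ from rfl, hder]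
  have : a ^ 2 * f t ≤ b ^ 2 * f t :=
    mul_le_mul_of_nonneg_right (pow_le_pow_left₀ ha hab 2) (hf t)
  nlinarith

lemma contDiff (h : IsPosPeriodicRiccatiSol f a lam) (hf : ContDiff ℝ ∞ f) :
    ContDiff ℝ ∞ lam := by
  have hder : deriv lam = fun t => a ^ 2 * f t - lam t ^ 2 :=
    funext fun t => (h.hasDerivAt t).deriv
  refine contDiff_infty.2 fun n => ?_
  induction n with
  -- Bootstrap: the equation makes `deriv lam` as regular as `lam`.
  | zero => exact contDiff_zero.2 h.differentiable.continuous
  | succ n ih =>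
    rw [Nat.cast_add, Nat.cast_one, contDiff_succ_iff_deriv]
    refine ⟨h.differentiable, by simp, ?_⟩
    rw [hder]
    exact (contDiff_const.mul (contDiff_infty.1 hf n)).sub (ih.pow 2)

/-- The average slope `periodIntegral lam / a` decreases with `a`: with `μ₁ = lam₂ / b`,
`μ₂ = lam₁ / a` and `d = μ₂ - μ₁`, the function `2 * d` is the sum of a nonnegative function and the
derivative of a periodic function. -/
lemma periodIntegral_div_le (h₁ : IsPosPeriodicRiccatiSol f a lam₁)
    (h₂ : IsPosPeriodicRiccatiSol f b lam₂) (hfc : Continuous f)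
    (hf : ∀ t, 0 ≤ f t) (ha : 0 < a) (hab : a < b) :
    periodIntegral lam₂ / b ≤ periodIntegral lam₁ / a := by
  have hb : 0 < b := ha.trans hab
  have hc₁ := h₁.differentiable.continuous
  have hc₂ := h₂.differentiable.continuous
  set d : ℝ → ℝ := fun t => lam₁ t / a - lam₂ t / b with hd
  set r : ℝ → ℝ := fun t => d t / (lam₁ t / a) with hr
  set δ : ℝ := a⁻¹ - b⁻¹ with hδ
  have hδ0 : 0 < δ := sub_pos.2 (inv_strictAnti₀ ha hab)
  -- Subtracting the equations for `x`, `y` and dividing by `x` gives `2 * d = d ^ 2 / x - b⁻¹ * r'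
  -- - δ * x' / x - b⁻¹ * r * x' / x`. The last term has no sign; the same identity times `b⁻¹ / δ *
  -- r` trades it for the derivative of the `r ^ 2` term, up to terms that join the remainder.
  set G : ℝ → ℝ := fun t => -b⁻¹ * r t - δ * Real.log (lam₁ t) + (b⁻¹ ^ 2 / δ / 2) * r t ^ 2 with hG
  set r' : ℝ → ℝ := fun t => (((a ^ 2 * f t - lam₁ t ^ 2) / a - (b ^ 2 * f t - lam₂ t ^ 2) / b) *
      (lam₁ t / a) - d t * ((a ^ 2 * f t - lam₁ t ^ 2) / a)) / (lam₁ t / a) ^ 2 with hr'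
  set G' : ℝ → ℝ := fun t => -b⁻¹ * r' t - δ * ((a ^ 2 * f t - lam₁ t ^ 2) / lam₁ t)
      + (b⁻¹ ^ 2 / δ / 2) * (2 * r t * r' t) with hG'
  have hrd : ∀ t, HasDerivAt r (r' t) t := fun t =>
    (((h₁.hasDerivAt t).div_const a).sub ((h₂.hasDerivAt t).div_const b)).div
      ((h₁.hasDerivAt t).div_const a) (div_pos (h₁.pos t) ha).ne'
  have hGd : ∀ t, HasDerivAt G (G' t) t := by
    intro t
    have := (((hrd t).const_mul (-b⁻¹)).sub
      (((h₁.hasDerivAt t).log (h₁.pos t).ne').const_mul δ)).add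
      (((hrd t).pow 2).const_mul (b⁻¹ ^ 2 / δ / 2))
    refine this.congr_deriv ?_
    simp [hG']
  have hle : ∀ t, G' t ≤ 2 * d t := by
    intro t
    have hx := h₁.pos t
    have hy := h₂.pos t
    have key : 2 * d t - G' t = d t ^ 2 / (lam₁ t / a) *
        (1 + b⁻¹ / a⁻¹ + b⁻¹ / δ * ((lam₂ t / b) / (lam₁ t / a))
          + b⁻¹ ^ 2 / (δ * a⁻¹) * (f t / (lam₁ t / a) ^ 2)) := by
      have hba : b - a ≠ 0 := (sub_pos.2 hab).ne'
      have hδ' : δ = (b - a) / (a * b) := by rw [hδ]; field_simp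
      simp only [hG', hr', hr, hd, hδ']
      field_simp
      ring
    have : 0 ≤ 2 * d t - G' t := by
      rw [key]
      have := hf t
      positivity
    linarith
  have hcG : Continuous G' := by
    have hcr : Continuous r :=
      continuous_iff_continuousAt.2 fun t => (hrd t).continuousAt
    have hn : ∀ t, (lam₁ t / a) ^ 2 ≠ 0 := fun t => (pow_pos (div_pos (h₁.pos t) ha) 2).ne'
    have hcr' : Continuous r' := by
      refine Continuous.div ?_ (by fun_prop) hn
      fun_prop
    have := fun t => (h₁.pos t).ne'
    fun_prop (disch := assumption)
  have hGper : G 1 = G 0 := by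
    have e₁ := h₁.periodic 0
    have e₂ := h₂.periodic 0
    rw [zero_add] at e₁ e₂
    simp only [hG, hr, hd, e₁, e₂]
  have hint : ∫ t in (0 : ℝ)..1, G' t = 0 := by
    rw [intervalIntegral.integral_eq_sub_of_hasDerivAt (fun t _ => hGd t)
      (hcG.intervalIntegrable _ _), hGper, sub_self]
  have hmono : ∫ t in (0 : ℝ)..1, G' t ≤ ∫ t in (0 : ℝ)..1, 2 * d t :=
    intervalIntegral.integral_mono zero_le_one (hcG.intervalIntegrable _ _)
      ((by fun_prop : Continuous fun t => 2 * d t).intervalIntegrable _ _) hle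
  rw [hint, intervalIntegral.integral_const_mul, hd, intervalIntegral.integral_sub
    ((hc₁.div_const a).intervalIntegrable _ _) ((hc₂.div_const b).intervalIntegrable _ _),
    intervalIntegral.integral_div, intervalIntegral.integral_div] at hmono
  unfold periodIntegral
  linarith

end IsPosPeriodicRiccatiSol

lemma existsUnique_isPosPeriodicRiccatiSol {f : ℝ → ℝ} (hf : Continuous f)
    (hper : Function.Periodic f 1) (hpos : ∀ t, 0 < f t) {a : ℝ} (ha : 0 < a) :
    ∃! lam : ℝ → ℝ, IsPosPeriodicRiccatiSol f a lam := by
  obtain ⟨t₀, ht₀⟩ := hper.exists_forall_ge_of_continuous hf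
  obtain ⟨t₁, ht₁⟩ := Function.Periodic.exists_forall_ge_of_continuous (d := fun t => -f t)
    (fun t => by simp only [hper t]) hf.neg
  have hsq : ∀ t, (a * √(f t)) ^ 2 = a ^ 2 * f t := fun t => by
    rw [mul_pow, Real.sq_sqrt (hpos t).le]
  have hle : ∀ t, f t ≤ f t₁ := fun t => neg_le_neg_iff.1 (ht₁ t)
  have hm : 0 < a * √(f t₀) := mul_pos ha (Real.sqrt_pos.2 (hpos t₀))
  obtain ⟨u, hup, hum, hud⟩ := exists_periodic_riccati (g := fun t => a ^ 2 * f t)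
    (m := a * √(f t₀)) (M := a * √(f t₁)) (by fun_prop)
    (fun t => by simp only [hper t]) hm
    (mul_le_mul_of_nonneg_left (Real.sqrt_le_sqrt (ht₀ t₁)) ha.le)
    (fun t => by rw [hsq]; exact mul_le_mul_of_nonneg_left (ht₀ t) (sq_nonneg a))
    (fun t => by rw [hsq]; exact mul_le_mul_of_nonneg_left (hle t) (sq_nonneg a))
  refine ⟨u, ⟨fun t => hm.trans_le (hum t), hup, fun t => (hud t).differentiableAt,
    fun t => by rw [(hud t).deriv]; ring⟩, fun v hv => funext fun t => ?_⟩
  have hu : IsPosPeriodicRiccatiSol f a u := ⟨fun t => hm.trans_le (hum t), hup,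
    fun t => (hud t).differentiableAt, fun t => by rw [(hud t).deriv]; ring⟩
  exact le_antisymm (hv.le_of_le hu (fun t => (hpos t).le) ha.le le_rfl t)
    (hu.le_of_le hv (fun t => (hpos t).le) ha.le le_rfl t)

theorem mainTheorem3 (f : ℝ → ℝ) (hf_smooth : ContDiff ℝ ∞ f)
    (hf_periodic : Function.Periodic f 1) (hf_pos : ∀ t : ℝ, 0 < f t) :
    (∀ a : ℝ, 0 < a → ∃! lam : ℝ → ℝ, IsPosPeriodicRiccatiSol f a lam) ∧
    ∀ lam : ℝ → ℝ → ℝ, (∀ a : ℝ, 0 < a → IsPosPeriodicRiccatiSol f a (lam a)) →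
      (∀ a : ℝ, 0 < a → ContDiff ℝ ∞ (lam a)) ∧
      AntitoneOn (fun a : ℝ => periodIntegral (lam a) / a) (Set.Ioi 0) ∧
      ∀ a : ℝ, 0 < a → a < 1 →
        periodIntegral (lam a) ≤ periodIntegral (lam 1) ∧
        periodIntegral (lam 1) ≤ periodIntegral (lam a) / a := by
  have hf_nonneg : ∀ t, 0 ≤ f t := fun t => (hf_pos t).le
  have hf_cont := hf_smooth.continuous
  refine ⟨fun a ha => existsUnique_isPosPeriodicRiccatiSol hf_cont hf_periodic hf_pos ha,
    fun lam hlam => ⟨fun a ha => (hlam a ha).contDiff hf_smooth, ?_, fun a ha ha1 => ⟨?_, ?_⟩⟩⟩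
  · intro a ha b hb hab
    rcases hab.eq_or_lt with rfl | hlt
    · exact le_rfl
    · exact (hlam a ha).periodIntegral_div_le (hlam b hb) hf_cont hf_nonneg ha hlt
  · exact intervalIntegral.integral_mono zero_le_one
      ((hlam a ha).differentiable.continuous.intervalIntegrable _ _)
      ((hlam 1 one_pos).differentiable.continuous.intervalIntegrable _ _)
      ((hlam a ha).le_of_le (hlam 1 one_pos) hf_nonneg ha.le ha1.le)
  · simpa using (hlam a ha).periodIntegral_div_le (hlam 1 one_pos) hf_cont hf_nonneg ha ha1
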